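/- Let $K$ be a complex $m\times n$ matrix, and let $A$ and $B$ range over the positive definite complex $m\times m$ and $n\times n$ matrices respectively. Real powers, logarithms and other functions of Hermitian matrices are taken in the sense of the functional calculus, $\overline B$ is the entrywise complex conjugate of $B$, and Hermitian matrices are ordered by $X\le Y$ iff $Y-X$ is positive semidefinite. All traces below are real. (a) For $p\in(0,1)\cup(1,2]$ let $g_p(x)=\frac1{1-p}(x-x^p)$ for $x>0$. Then $$(I\otimes\overline B)\,g_p(A\otimes\overline B^{-1})=\tfrac1{1-p}\big(A\otimes I-A^p\otimes\overline B^{\,1-p}\big),$$ this map of $(A,B)$ is jointly convex, and so is $$(A,B)\mapsto\tfrac1{1-p}\operatorname{Tr}\big(K^*AK-K^*A^pKB^{1-p}\big).$$ (c) For $q\in[-1,0)\cup(0,1)$ let $h_q(x)=\frac1q(1-x^q)$ for $x>0$. Then $$(I\otimes\overline B)\,h_q(A\otimes\overline B^{-1})=\tfrac1q\big(I\otimes\overline B-A^q\otimes\overline B^{\,1-q}\big),$$ this map of $(A,B)$ is jointly convex, and so is $$(A,B)\mapsto\tfrac1q\operatorname{Tr}\big(K^*KB-K^*A^qKB^{1-q}\big).$$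 Consequently, for every $p\in[-1,2]\setminus\{0,1\}$ the map $(A,B)\mapsto\frac1{p(1-p)}\operatorname{Tr}K^*A^pKB^{1-p}$ is jointly concave. This extends by continuity to $p=1$ and $p=0$ once the term $\operatorname{Tr}K^*AK$, respectively $\operatorname{Tr}K^*KB$, which is linear in $(A,B)$, is subtracted: for all $A,B>0$, $$\lim_{p\to1}\tfrac1{p(1-p)}\big(\operatorname{Tr}K^*A^pKB^{1-p}-\operatorname{Tr}K^*AK\big)=-\operatorname{Tr}\big(K^*(A\log A)K-K^*AK\log B\big),$$ $$\lim_{p\to0}\tfrac1{p(1-p)}\big(\operatorname{Tr}K^*A^pKB^{1-p}-\operatorname{Tr}K^*KB\big)=-\operatorname{Tr}\big(K^*K(B\log B)-K^*(\log A)KB\big),$$ and both limits are jointly concave in $(A,B)$. In particular, $(A,B)\mapsto\operatorname{Tr}K^*A^pKB^{1-p}$ is jointly concave for $p\in(0,1)$ (Lieb) and jointly convex for $p\in[1,2]$ (Ando). -/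

import Mathlib

open scoped MatrixOrder ComplexOrder Kronecker Matrix Topology

namespace LiebAndo

/-- The functions `g_p` on `(0, ∞)`: `g_p(x) = (x - x^p) / (1 - p)` for `p ≠ 1`, and
`g_1(x) = x log x`. -/
noncomputable def g (p x : ℝ) : ℝ :=
  if p = 1 then x * Real.log x else 1 / (1 - p) * (x - x ^ p)

/-- The functions `h_q` on `(0, ∞)`: `h_q(x) = (1 - x^q) / q` for `q ≠ 0`, and
`h_0(x) = - log x`. -/
noncomputable def h (q x : ℝ) : ℝ :=
  if q = 0 then -Real.log x else 1 / q * (1 - x ^ q)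

/-- The pairs `(A, B)` of positive definite complex matrices. -/
def posPairs (m n : Type*) : Set (Matrix m m ℂ × Matrix n n ℂ) :=
  {P | P.1.PosDef ∧ P.2.PosDef}

/-- `(A, B) ↦ F A B` is jointly convex in `A, B > 0`. The values are real numbers, or Hermitian
matrices with the Loewner order. -/
def JointlyConvex {m n β : Type*} [AddCommMonoid β] [PartialOrder β] [SMul ℝ β]
    (F : Matrix m m ℂ → Matrix n n ℂ → β) : Prop :=
  ConvexOn ℝ (posPairs m n) (fun P => F P.1 P.2)

/-- `(A, B) ↦ F A B` is jointly concave in `A, B > 0`. -/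
def JointlyConcave {m n β : Type*} [AddCommMonoid β] [PartialOrder β] [SMul ℝ β]
    (F : Matrix m m ℂ → Matrix n n ℂ → β) : Prop :=
  ConcaveOn ℝ (posPairs m n) (fun P => F P.1 P.2)

variable {m n : Type*} [Fintype m] [DecidableEq m] [Fintype n] [DecidableEq n]

/-- The operator `(I ⊗ B̄) f(A ⊗ B̄⁻¹)`, where `B̄` is the entrywise complex conjugate of `B` and
`f` is applied by the functional calculus of Hermitian matrices. -/
noncomputable def perspective (f : ℝ → ℝ) (A : Matrix m m ℂ) (B : Matrix n n ℂ) :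
    Matrix (m × n) (m × n) ℂ :=
  ((1 : Matrix m m ℂ) ⊗ₖ B.map star) * cfc f (A ⊗ₖ (B.map star)⁻¹)

/-- The trace `Tr K* A^p K B^(1-p)`, with real powers of positive definite matrices. -/
noncomputable def liebTrace (K : Matrix m n ℂ) (p : ℝ) (A : Matrix m m ℂ) (B : Matrix n n ℂ) : ℂ :=
  (Kᴴ * A ^ p * K * B ^ (1 - p)).trace

/-- The matrix logarithm of a positive definite matrix. -/
noncomputable def matLog (A : Matrix m m ℂ) : Matrix m m ℂ := cfc Real.log A

end LiebAndo

/-! Everything follows from joint operator concavity of `A^p ⊗ B^(1-p)` for `p ∈ [0, 1]`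
(`jointlyConcave_tpow`). The exponents for which it holds form a closed set containing `0` and `1`,
where the map is linear. This set is stable under midpoints: the power at `(p + q) / 2` is the
geometric mean of the commuting powers at `p` and `q`, and that mean is the largest Hermitian `G`
for which the block matrix with diagonal the two powers and off-diagonal `G` is positive
semidefinite (`le_mul_of_posSemidef_fromBlocks`). Such block matrices can be averaged and their
diagonals enlarged.

On `[-1, 0]` and `[1, 2]` the power equals `X W⁻¹ X` with `X` linear and `W` a power already known
to be concave; a Schur complement argument turns this into convexity (`jointlyConvex_tpow`).

The perspectives of `g p` and `h q` are differences of such powers in `A` and `B̄`. The trace `Tr K*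
A^p K B^(1-p)` is the quadratic form of `A^p ⊗ B̄^(1-p)` at the vector of entries of `K`, so it
inherits convexity or concavity. The logarithmic cases are derivatives in `p`, and concavity passes
to pointwise limits. -/

namespace LiebAndo

/-! ### Functional calculus through unitary diagonalization. -/

section Spectral

variable {m n : Type*} [Fintype m] [DecidableEq m] [Fintype n] [DecidableEq n]

/-- The star homomorphism sending `d` to `U * diagonal d * U⋆`, for `U` unitary. -/
noncomputable def conjDiag (U : Matrix.unitaryGroup m ℂ) : (m → ℂ) →⋆ₐ[ℝ] Matrix m m ℂ where
  toFun d := U * Matrix.diagonal d * (star U : Matrix.unitaryGroup m ℂ)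
  map_one' := by simp
  map_mul' x y := by
    have hU : (star (U : Matrix m m ℂ)) * (U : Matrix m m ℂ) = 1 := by simp
    have : Matrix.diagonal (x * y) = Matrix.diagonal x * Matrix.diagonal y := by
      simp [Matrix.diagonal_mul_diagonal, Pi.mul_def]
    rw [this]
    simp only [Unitary.coe_star]
    simp only [mul_assoc]
    rw [← mul_assoc (star (U : Matrix m m ℂ)) (U : Matrix m m ℂ), hU, one_mul]
  map_zero' := by simp
  map_add' x y := by
    have : Matrix.diagonal (x + y) = Matrix.diagonal x + Matrix.diagonal y := by
      simp [Matrix.diagonal_add, Pi.add_def]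
    rw [this, mul_add, add_mul]
  commutes' r := by
    have : Matrix.diagonal (algebraMap ℝ (m → ℂ) r) = (r : ℂ) • (1 : Matrix m m ℂ) := by
      ext i j; by_cases h : i = j <;> simp [Matrix.diagonal, h]
    rw [this]
    ext i j
    simp [Matrix.algebraMap_matrix_apply, Matrix.one_apply]
  map_star' x := by
    have : Matrix.diagonal (star x) = star (Matrix.diagonal x) := by
      simp [Matrix.star_eq_conjTranspose]
    rw [this]
    simp [mul_assoc]

lemma conjDiag_apply (U : Matrix.unitaryGroup m ℂ) (d : m → ℂ) :
    conjDiag U d = U * Matrix.diagonal d * (U : Matrix m m ℂ)ᴴ := rfl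

lemma continuous_conjDiag (U : Matrix.unitaryGroup m ℂ) : Continuous (conjDiag U) := by
  change Continuous fun d : m → ℂ => (U : Matrix m m ℂ) * Matrix.diagonal d * (U : Matrix m m ℂ)ᴴ
  fun_prop

/-- The spectrum is contained in the finite set of values of `d`, so `f` may be replaced by its
Lagrange interpolant there, and algebra homomorphisms commute with polynomials. No continuity of `f`
is needed. -/
lemma cfc_conjDiag (f : ℝ → ℝ) (U : Matrix.unitaryGroup m ℂ) (d : m → ℝ) :
    cfc f (conjDiag U fun i => (d i : ℂ)) = conjDiag U fun i => (f (d i) : ℂ) := by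
  have hsa : IsSelfAdjoint fun i => (d i : ℂ) := by
    ext i; simp
  set q : Polynomial ℝ := Lagrange.interpolate (Finset.univ.image d) id f
  have hqd : ∀ i, q.eval (d i) = f (d i) := fun i =>
    Lagrange.eval_interpolate_at_node (v := id) f Function.injective_id.injOn
      (Finset.mem_image_of_mem d (Finset.mem_univ i))
  have hspec : Set.EqOn f q.eval (spectrum ℝ (conjDiag U fun i => (d i : ℂ))) := by
    intro r hr
    have hr' := AlgHom.spectrum_apply_subset (conjDiag U) _ hr
    rw [Pi.spectrum_eq, Set.mem_iUnion] at hr'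
    obtain ⟨i, hi⟩ := hr'
    have : r = d i := by
      by_contra hne
      refine hi ?_
      rw [spectrum.mem_resolventSet_iff, Complex.coe_algebraMap, ← Complex.ofReal_sub, isUnit_iff_ne_zero]
      exact_mod_cast sub_ne_zero.2 hne
    rw [this, ← hqd]
  rw [cfc_congr hspec, cfc_polynomial q _ (hsa.map (conjDiag U))]
  have := Polynomial.aeval_algHom_apply (conjDiag U).toAlgHom (fun i => (d i : ℂ)) q
  refine this.trans (congrArg (conjDiag U) (funext fun i => ?_))
  rw [← hqd, Polynomial.aeval_pi_apply₂]
  exact Polynomial.aeval_algebraMap_apply_eq_algebraMap_eval (A := ℂ) (d i) q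

lemma exists_eq_conjDiag {A : Matrix m m ℂ} (hA : A.PosDef) :
    ∃ (U : Matrix.unitaryGroup m ℂ) (d : m → ℝ), (∀ i, 0 < d i) ∧
      A = conjDiag U fun i => (d i : ℂ) :=
  ⟨hA.1.eigenvectorUnitary, hA.1.eigenvalues, hA.eigenvalues_pos, hA.1.spectral_theorem⟩

lemma posDef_conjDiag (U : Matrix.unitaryGroup m ℂ) {d : m → ℝ} (hd : ∀ i, 0 < d i) :
    (conjDiag U fun i => (d i : ℂ)).PosDef := by
  rw [conjDiag_apply]
  refine (Matrix.IsUnit.posDef_star_right_conjugate_iff (U := (U : Matrix m m ℂ))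
    (Unitary.toUnits U).isUnit).2 ?_
  exact Matrix.PosDef.diagonal fun i => by exact_mod_cast hd i

lemma rpow_conjDiag (U : Matrix.unitaryGroup m ℂ) {d : m → ℝ} (hd : ∀ i, 0 < d i) (p : ℝ) :
    (conjDiag U fun i => (d i : ℂ)) ^ p = conjDiag U fun i => ((d i ^ p : ℝ) : ℂ) := by
  rw [CFC.rpow_eq_cfc_real (Matrix.nonneg_iff_posSemidef.2 (posDef_conjDiag U hd).posSemidef),
    cfc_conjDiag]

lemma posDef_rpow {A : Matrix m m ℂ} (hA : A.PosDef) (p : ℝ) : (A ^ p).PosDef := by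
  obtain ⟨U, d, hd, rfl⟩ := exists_eq_conjDiag hA
  rw [rpow_conjDiag U hd]
  exact posDef_conjDiag U fun i => Real.rpow_pos_of_pos (hd i) p

lemma rpow_add {A : Matrix m m ℂ} (hA : A.PosDef) (p q : ℝ) : A ^ (p + q) = A ^ p * A ^ q :=
  CFC.rpow_add hA.isUnit

lemma rpow_zero {A : Matrix m m ℂ} (hA : A.PosDef) : A ^ (0 : ℝ) = 1 :=
  CFC.rpow_zero A (Matrix.nonneg_iff_posSemidef.2 hA.posSemidef)

lemma rpow_one {A : Matrix m m ℂ} (hA : A.PosDef) : A ^ (1 : ℝ) = A :=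
  CFC.rpow_one A (Matrix.nonneg_iff_posSemidef.2 hA.posSemidef)

lemma continuous_rpow {A : Matrix m m ℂ} (hA : A.PosDef) : Continuous fun p : ℝ => A ^ p := by
  obtain ⟨U, d, hd, rfl⟩ := exists_eq_conjDiag hA
  simp only [rpow_conjDiag U hd]
  refine (continuous_conjDiag U).comp (continuous_pi fun i => Complex.continuous_ofReal.comp ?_)
  exact Real.continuous_const_rpow (hd i).ne'

/-- The unitary `W = U ⊗ V` is chosen before `x` and `y`, so that a Kronecker product and all its
powers are diagonalized by the same `W`. -/
lemma conjDiag_kronecker (U : Matrix.unitaryGroup m ℂ) (V : Matrix.unitaryGroup n ℂ) :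
    ∃ W : Matrix.unitaryGroup (m × n) ℂ, ∀ (x : m → ℂ) (y : n → ℂ),
      conjDiag U x ⊗ₖ conjDiag V y = conjDiag W fun i => x i.1 * y i.2 := by
  refine ⟨⟨(U : Matrix m m ℂ) ⊗ₖ (V : Matrix n n ℂ), Matrix.kronecker_mem_unitary U.2 V.2⟩, ?_⟩
  intro x y
  simp only [conjDiag_apply, Matrix.conjTranspose_kronecker, Matrix.mul_kronecker_mul,
    Matrix.diagonal_kronecker_diagonal]

lemma kronecker_rpow {A : Matrix m m ℂ} {B : Matrix n n ℂ} (hA : A.PosDef) (hB : B.PosDef)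
    (p : ℝ) : (A ⊗ₖ B) ^ p = (A ^ p) ⊗ₖ (B ^ p) := by
  obtain ⟨U, d, hd, rfl⟩ := exists_eq_conjDiag hA
  obtain ⟨V, e, he, rfl⟩ := exists_eq_conjDiag hB
  obtain ⟨W, hW⟩ := conjDiag_kronecker U V
  rw [rpow_conjDiag U hd, rpow_conjDiag V he, hW, hW]
  have := rpow_conjDiag W (d := fun i => d i.1 * e i.2) (fun i => mul_pos (hd _) (he _)) p
  simp only [Real.mul_rpow (hd _).le (he _).le] at this
  push_cast at this ⊢
  exact this

/-- Conjugation replaces `U` by its entrywise conjugate and leaves the real diagonal unchanged;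
hence it commutes with real powers. -/
lemma map_star_conjDiag (U : Matrix.unitaryGroup m ℂ) :
    ∃ W : Matrix.unitaryGroup m ℂ, ∀ d : m → ℝ,
      (conjDiag U fun i => (d i : ℂ)).map star = conjDiag W fun i => (d i : ℂ) := by
  have hmul : ∀ M N : Matrix m m ℂ, (M * N).map star = M.map star * N.map star := fun M N =>
    Matrix.map_mul (f := starRingEnd ℂ)
  have hU : (U : Matrix m m ℂ) * (U : Matrix m m ℂ)ᴴ = 1 := Unitary.mul_star_self_of_mem U.2
  refine ⟨⟨(U : Matrix m m ℂ).map star, Matrix.mem_unitaryGroup_iff.2 ?_⟩, fun d => ?_⟩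
  · have := congrArg (fun M => M.map star) hU
    simp only [hmul] at this
    rw [Matrix.map_one _ (star_zero _) (star_one _)] at this
    exact this
  · simp only [conjDiag_apply, hmul]
    congr 2
    rw [Matrix.diagonal_map (star_zero _)]
    congr 1
    funext i
    simp

lemma posDef_map_star {B : Matrix n n ℂ} (hB : B.PosDef) : (B.map star).PosDef := by
  obtain ⟨V, e, he, rfl⟩ := exists_eq_conjDiag hB
  obtain ⟨W, hW⟩ := map_star_conjDiag V
  rw [hW]
  exact posDef_conjDiag W he

lemma map_star_rpow {B : Matrix n n ℂ} (hB : B.PosDef) (p : ℝ) :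
    (B.map star) ^ p = (B ^ p).map star := by
  obtain ⟨V, e, he, rfl⟩ := exists_eq_conjDiag hB
  obtain ⟨W, hW⟩ := map_star_conjDiag V
  rw [hW, rpow_conjDiag W he, rpow_conjDiag V he, hW]

/-- In eigenbases of `A` and `B` the trace becomes a scalar sum with nonnegative weights independent
of the eigenvalues; its reality and its derivative in `p` can then be read off termwise. -/
lemma trace_conjDiag (K : Matrix m n ℂ) (U : Matrix.unitaryGroup m ℂ)
    (V : Matrix.unitaryGroup n ℂ) (x : m → ℂ) (y : n → ℂ) :
    (Kᴴ * conjDiag U x * K * conjDiag V y).trace =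
      ∑ j, ∑ i, (Complex.normSq (((U : Matrix m m ℂ)ᴴ * K * (V : Matrix n n ℂ)) i j) : ℂ)
        * (x i * y j) := by
  set M := (U : Matrix m m ℂ)ᴴ * K * (V : Matrix n n ℂ) with hM
  have : (Kᴴ * conjDiag U x * K * conjDiag V y).trace =
      (Mᴴ * Matrix.diagonal x * M * Matrix.diagonal y).trace := by
    simp only [conjDiag_apply, hM, Matrix.conjTranspose_mul, Matrix.conjTranspose_conjTranspose]
    rw [← mul_assoc, Matrix.trace_mul_comm]
    simp only [Matrix.mul_assoc]
  rw [this, Matrix.trace]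
  refine Finset.sum_congr rfl fun j _ => ?_
  rw [Matrix.diag_apply, Matrix.mul_diagonal, Matrix.mul_apply, Finset.sum_mul]
  refine Finset.sum_congr rfl fun i _ => ?_
  rw [Matrix.mul_diagonal, Matrix.conjTranspose_apply, Complex.normSq_eq_conj_mul_self,
    Complex.star_def]
  ring

end Spectral

/-! ### Positive semidefinite block matrices and the geometric mean. -/

section Blocks

variable {m : Type*} [Fintype m] [DecidableEq m]

/-- For Hermitian `H` and positive semidefinite `C`, `H² ≤ C²` implies `H ≤ C`. -/
lemma le_of_mul_self_le {H C : Matrix m m ℂ} (hH : H.IsHermitian) (hC : C.PosSemidef)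
    (h : H * H ≤ C * C) : H ≤ C := by
  have hD : (C - H).IsHermitian := hC.1.sub hH
  refine Matrix.le_iff.2 (hD.posSemidef_iff_eigenvalues_nonneg.2 fun i => ?_)
  by_contra! hneg
  rw [Pi.zero_apply] at hneg
  set μ := hD.eigenvalues i
  set v : m → ℂ := ⇑(hD.eigenvectorBasis i)
  have hv0 : v ≠ 0 := fun h0 => hD.eigenvectorBasis.orthonormal.ne_zero i (by ext j; exact congrFun h0 j)
  have hvpos : 0 < star v ⬝ᵥ v := Matrix.dotProduct_star_self_pos_iff.2 hv0
  have heig : H *ᵥ v = C *ᵥ v - (μ : ℂ) • v := by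
    have h1 : (C - H) *ᵥ v = μ • v := hD.mulVec_eigenvectorBasis i
    have h2 : μ • v = (μ : ℂ) • v := by ext j; simp
    rw [← h2, ← h1, Matrix.sub_mulVec, sub_sub_cancel]
  have hsq : ∀ M : Matrix m m ℂ, M.IsHermitian →
      star v ⬝ᵥ ((M * M) *ᵥ v) = star (M *ᵥ v) ⬝ᵥ (M *ᵥ v) := fun M hM => by
    rw [← Matrix.mulVec_mulVec, Matrix.dotProduct_mulVec, Matrix.star_mulVec, hM.eq]
  -- With `(C - H) v = μ v` and `μ < 0`, one gets `‖Cv‖² - ‖Hv‖² = 2μ⟨v, Cv⟩ - μ²‖v‖² < 0`, against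
  -- `H² ≤ C²`.
  have h3 := (Matrix.le_iff.1 h).dotProduct_mulVec_nonneg v
  rw [Matrix.sub_mulVec, dotProduct_sub, hsq C hC.1, hsq H hH, heig] at h3
  have h4 : star (C *ᵥ v) ⬝ᵥ v = star v ⬝ᵥ (C *ᵥ v) := by
    rw [Matrix.star_mulVec, hC.1.eq, Matrix.dotProduct_mulVec]
  have h5 := hC.dotProduct_mulVec_nonneg v
  have h6 : star (μ : ℂ) = μ := by simp
  simp only [star_sub, star_smul, sub_dotProduct, dotProduct_sub, smul_dotProduct,
    dotProduct_smul, smul_eq_mul, h4, h6] at h3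
  have h7 := (Complex.le_def.1 h3).1
  have h8 := (Complex.le_def.1 h5).1
  have h9 := (Complex.lt_def.1 hvpos).1
  simp only [Complex.sub_re, Complex.zero_re, Complex.re_ofReal_mul] at h7 h8 h9
  nlinarith [mul_pos (mul_pos_of_neg_of_neg hneg hneg) h9, mul_nonneg_of_nonpos_of_nonpos hneg.le (neg_nonpos.2 h8)]

/-- The geometric mean `R * S` of `R²` and `S²`, for commuting `R` and `S`, dominates every `G`
making the block matrix positive semidefinite. -/
lemma le_mul_of_posSemidef_fromBlocks {R S G : Matrix m m ℂ} (hR : R.PosDef)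
    (hG : G.IsHermitian) (hc : R * S = S * R) (hRS : (R * S).PosSemidef)
    (h : (Matrix.fromBlocks (R * R) G G (S * S)).PosSemidef) : G ≤ R * S := by
  have hu : IsUnit R.det := (Matrix.isUnit_iff_isUnit_det R).1 hR.isUnit
  have hRR : (R * R).PosDef := by
    have := Matrix.PosDef.conjTranspose_mul_self R
      (Matrix.mulVec_injective_of_isUnit hR.isUnit)
    rwa [hR.1.eq] at this
  have hinv : R⁻¹ * R = 1 := Matrix.nonsing_inv_mul R hu
  have hinv' : R * R⁻¹ = 1 := Matrix.mul_nonsing_inv R hu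
  have hRi : (R⁻¹).IsHermitian := hR.inv.1
  have : Invertible (R * R) := hRR.isUnit.invertible
  have h1 : (Matrix.fromBlocks (R * R) G Gᴴ (S * S)).PosSemidef := by rwa [hG.eq]
  -- The Schur complement gives `G R⁻² G ≤ S²`. Conjugating by `R⁻¹`, which commutes with `S`, gives
  -- `(R⁻¹ G R⁻¹)² ≤ (R⁻¹ S)²`; the square root of this inequality is then conjugated back by `R`.
  rw [Matrix.PosDef.fromBlocks₁₁ _ _ hRR, hG.eq, Matrix.mul_inv_rev] at h1
  have h2 := h1.conjTranspose_mul_mul_same R⁻¹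
  rw [hRi.eq] at h2
  have hcomm : R⁻¹ * S = S * R⁻¹ := by
    calc R⁻¹ * S = R⁻¹ * (S * R) * R⁻¹ := by
          rw [Matrix.mul_assoc, Matrix.mul_assoc, hinv', Matrix.mul_one]
      _ = S * R⁻¹ := by rw [← hc, ← Matrix.mul_assoc, hinv, Matrix.one_mul]
  have hC : (R⁻¹ * S).PosSemidef := by
    have h3 := hRS.conjTranspose_mul_mul_same R⁻¹
    rw [hRi.eq, ← Matrix.mul_assoc, hinv, Matrix.one_mul, ← hcomm] at h3
    exact h3
  have hH : (R⁻¹ * G * R⁻¹).IsHermitian := by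
    have := Matrix.isHermitian_conjTranspose_mul_mul R⁻¹ hG
    rwa [hRi.eq] at this
  have hle : R⁻¹ * G * R⁻¹ ≤ R⁻¹ * S := by
    refine le_of_mul_self_le hH hC (Matrix.le_iff.2 ?_)
    have e : R⁻¹ * S * (R⁻¹ * S) - R⁻¹ * G * R⁻¹ * (R⁻¹ * G * R⁻¹) =
        R⁻¹ * (S * S - G * (R⁻¹ * R⁻¹) * G) * R⁻¹ := by
      rw [Matrix.mul_sub, Matrix.sub_mul]
      congr 1
      · calc R⁻¹ * S * (R⁻¹ * S) = R⁻¹ * S * (S * R⁻¹) := by rw [hcomm]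
          _ = _ := by simp only [Matrix.mul_assoc]
      · simp only [Matrix.mul_assoc]
    rwa [e]
  have h4 := (Matrix.le_iff.1 hle).conjTranspose_mul_mul_same R
  refine Matrix.le_iff.2 ?_
  have e : R * S - G = Rᴴ * (R⁻¹ * S - R⁻¹ * G * R⁻¹) * R := by
    rw [hR.1.eq, Matrix.mul_sub, Matrix.sub_mul]
    congr 1
    · rw [← Matrix.mul_assoc, hinv', Matrix.one_mul, hc]
    · rw [Matrix.mul_assoc, Matrix.mul_assoc, hinv, Matrix.mul_one,
        ← Matrix.mul_assoc, hinv', Matrix.one_mul]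
  rwa [e]

omit [DecidableEq m] in
lemma posSemidef_fromBlocks_diagonal {P Q : Matrix m m ℂ} (hP : P.PosSemidef)
    (hQ : Q.PosSemidef) : (Matrix.fromBlocks P 0 0 Q).PosSemidef := by
  refine .of_dotProduct_mulVec_nonneg (hP.1.fromBlocks (by simp) hQ.1) fun x => ?_
  rw [Matrix.fromBlocks_mulVec]
  have : star x ⬝ᵥ Sum.elim (P *ᵥ (x ∘ Sum.inl) + 0 *ᵥ (x ∘ Sum.inr))
      (0 *ᵥ (x ∘ Sum.inl) + Q *ᵥ (x ∘ Sum.inr)) =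
      star (x ∘ Sum.inl) ⬝ᵥ (P *ᵥ (x ∘ Sum.inl)) + star (x ∘ Sum.inr) ⬝ᵥ (Q *ᵥ (x ∘ Sum.inr)) := by
    simp [dotProduct, Fintype.sum_sum_type]
  rw [this]
  exact add_nonneg (hP.dotProduct_mulVec_nonneg _) (hQ.dotProduct_mulVec_nonneg _)

omit [DecidableEq m] in
/-- A convex combination of positive semidefinite blocks, with the diagonal enlarged. -/
lemma posSemidef_fromBlocks_convexComb {P₁ G₁ Q₁ P₂ G₂ Q₂ P Q : Matrix m m ℂ}
    (h₁ : (Matrix.fromBlocks P₁ G₁ G₁ Q₁).PosSemidef)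
    (h₂ : (Matrix.fromBlocks P₂ G₂ G₂ Q₂).PosSemidef) {a b : ℝ} (ha : 0 ≤ a) (hb : 0 ≤ b)
    (hP : a • P₁ + b • P₂ ≤ P) (hQ : a • Q₁ + b • Q₂ ≤ Q) :
    (Matrix.fromBlocks P (a • G₁ + b • G₂) (a • G₁ + b • G₂) Q).PosSemidef := by
  have h := ((h₁.smul ha).add (h₂.smul hb)).add
    (posSemidef_fromBlocks_diagonal (Matrix.le_iff.1 hP) (Matrix.le_iff.1 hQ))
  simpa [Matrix.fromBlocks_smul, Matrix.fromBlocks_add] using h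

end Blocks

/-! ### Joint concavity and convexity of `A^p ⊗ B^(1-p)`. -/

section Core

variable {m n : Type*} [Fintype m] [DecidableEq m] [Fintype n] [DecidableEq n]

/-- The tensor product of powers `A^s ⊗ B^t`. -/
noncomputable def tpow (s t : ℝ) (A : Matrix m m ℂ) (B : Matrix n n ℂ) :
    Matrix (m × n) (m × n) ℂ := (A ^ s) ⊗ₖ (B ^ t)

lemma posDef_tpow {A : Matrix m m ℂ} {B : Matrix n n ℂ} (hA : A.PosDef) (hB : B.PosDef)
    (s t : ℝ) : (tpow s t A B).PosDef :=
  (posDef_rpow hA s).kronecker (posDef_rpow hB t)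

lemma tpow_mul {A : Matrix m m ℂ} {B : Matrix n n ℂ} (hA : A.PosDef) (hB : B.PosDef)
    (s t s' t' : ℝ) : tpow s t A B * tpow s' t' A B = tpow (s + s') (t + t') A B := by
  simp only [tpow, rpow_add hA, rpow_add hB, Matrix.mul_kronecker_mul]

lemma tpow_inv {A : Matrix m m ℂ} {B : Matrix n n ℂ} (hA : A.PosDef) (hB : B.PosDef)
    (s t : ℝ) : (tpow s t A B)⁻¹ = tpow (-s) (-t) A B := by
  refine Matrix.inv_eq_right_inv ?_
  rw [tpow_mul hA hB, add_neg_cancel, add_neg_cancel, tpow, rpow_zero hA, rpow_zero hB,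
    Matrix.one_kronecker_one]

lemma schur_tpow {A : Matrix m m ℂ} {B : Matrix n n ℂ} (hA : A.PosDef) (hB : B.PosDef)
    (s t u v : ℝ) : tpow u v A B * (tpow s t A B)⁻¹ * tpow u v A B =
      tpow (2 * u - s) (2 * v - t) A B := by
  rw [tpow_inv hA hB, tpow_mul hA hB, tpow_mul hA hB]
  congr 1 <;> ring

/-- The lower right corner is exactly `G P⁻¹ G` for the other entries `P` and `G`, so the Schur
complement vanishes. -/
lemma posSemidef_fromBlocks_tpow {A : Matrix m m ℂ} {B : Matrix n n ℂ} (hA : A.PosDef)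
    (hB : B.PosDef) (s t u v : ℝ) :
    (Matrix.fromBlocks (tpow s t A B) (tpow u v A B) (tpow u v A B)
      (tpow (2 * u - s) (2 * v - t) A B)).PosSemidef := by
  have hP := posDef_tpow hA hB s t
  have hG := (posDef_tpow hA hB u v).1
  have : Invertible (tpow s t A B) := hP.isUnit.invertible
  have h := (Matrix.PosDef.fromBlocks₁₁ (tpow u v A B) (tpow (2 * u - s) (2 * v - t) A B) hP).2
  rw [hG.eq, schur_tpow hA hB, sub_self] at h
  exact h .zero

omit [Fintype m] [DecidableEq m] in
lemma posDef_convexComb {M N : Matrix m m ℂ} (hM : M.PosDef) (hN : N.PosDef) {a b : ℝ}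
    (ha : 0 ≤ a) (hb : 0 ≤ b) (hab : a + b = 1) : (a • M + b • N).PosDef := by
  rcases ha.eq_or_lt with rfl | ha'
  · have : b = 1 := by linarith
    simpa [this] using hN
  · exact (hM.smul ha').add_posSemidef (hN.posSemidef.smul hb)

omit [Fintype m] [DecidableEq m] [Fintype n] [DecidableEq n] in
lemma convex_posPairs : Convex ℝ (posPairs m n) := fun _ hP _ hQ _ _ ha hb hab =>
  ⟨posDef_convexComb hP.1 hQ.1 ha hb hab, posDef_convexComb hP.2 hQ.2 ha hb hab⟩

/-- If `A^p ⊗ B^(1-p)` is concave for two exponents, it is so for their midpoint. -/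
lemma jointlyConcave_tpow_midpoint {p q : ℝ}
    (hp : JointlyConcave (tpow (m := m) (n := n) p (1 - p)))
    (hq : JointlyConcave (tpow (m := m) (n := n) q (1 - q))) :
    JointlyConcave (tpow (m := m) (n := n) ((p + q) / 2) (1 - (p + q) / 2)) := by
  refine ⟨convex_posPairs, fun P hP Q hQ a b ha hb hab => ?_⟩
  have hR := convex_posPairs hP hQ ha hb hab
  have hp' := hp.2 hP hQ ha hb hab
  have hq' := hq.2 hP hQ ha hb hab
  change a • tpow p (1 - p) P.1 P.2 + b • tpow p (1 - p) Q.1 Q.2 ≤ tpow p (1 - p) _ _ at hp'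
  change a • tpow q (1 - q) P.1 P.2 + b • tpow q (1 - q) Q.1 Q.2 ≤ tpow q (1 - q) _ _ at hq'
  set R := a • P + b • Q
  have e1 : 2 * ((p + q) / 2) - p = q := by ring
  have e2 : 2 * (1 - (p + q) / 2) - (1 - p) = 1 - q := by ring
  have h1 := posSemidef_fromBlocks_tpow hP.1 hP.2 p (1 - p) ((p + q) / 2) (1 - (p + q) / 2)
  have h2 := posSemidef_fromBlocks_tpow hQ.1 hQ.2 p (1 - p) ((p + q) / 2) (1 - (p + q) / 2)
  rw [e1, e2] at h1 h2
  have h := posSemidef_fromBlocks_convexComb h1 h2 ha hb hp' hq'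
  -- Half powers write the diagonal blocks as squares of two commuting matrices whose product is the
  -- power at the midpoint.
  have f : ∀ r, tpow r (1 - r) R.1 R.2 =
      tpow (r / 2) ((1 - r) / 2) R.1 R.2 * tpow (r / 2) ((1 - r) / 2) R.1 R.2 := fun r => by
    rw [tpow_mul hR.1 hR.2, add_halves, add_halves]
  have g : tpow (p / 2) ((1 - p) / 2) R.1 R.2 * tpow (q / 2) ((1 - q) / 2) R.1 R.2 =
      tpow ((p + q) / 2) (1 - (p + q) / 2) R.1 R.2 := by
    rw [tpow_mul hR.1 hR.2]; congr 1 <;> ring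
  have g' : tpow (q / 2) ((1 - q) / 2) R.1 R.2 * tpow (p / 2) ((1 - p) / 2) R.1 R.2 =
      tpow ((p + q) / 2) (1 - (p + q) / 2) R.1 R.2 := by
    rw [tpow_mul hR.1 hR.2]; congr 1 <;> ring
  rw [f p, f q] at h
  have hT := le_mul_of_posSemidef_fromBlocks (posDef_tpow hR.1 hR.2 _ _)
    (((posDef_tpow hP.1 hP.2 _ _).posSemidef.smul ha).add
      ((posDef_tpow hQ.1 hQ.2 _ _).posSemidef.smul hb)).1
    (g.trans g'.symm)
    (g ▸ (posDef_tpow hR.1 hR.2 _ _).posSemidef) h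
  rwa [g] at hT

lemma tpow_one_zero {A : Matrix m m ℂ} {B : Matrix n n ℂ} (hA : A.PosDef) (hB : B.PosDef) :
    tpow 1 0 A B = A ⊗ₖ (1 : Matrix n n ℂ) := by
  rw [tpow, rpow_one hA, rpow_zero hB]

lemma tpow_zero_one {A : Matrix m m ℂ} {B : Matrix n n ℂ} (hA : A.PosDef) (hB : B.PosDef) :
    tpow 0 1 A B = (1 : Matrix m m ℂ) ⊗ₖ B := by
  rw [tpow, rpow_zero hA, rpow_one hB]

lemma tpow_one_zero_comb {P Q : Matrix m m ℂ × Matrix n n ℂ} (hP : P ∈ posPairs m n)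
    (hQ : Q ∈ posPairs m n) {a b : ℝ} (ha : 0 ≤ a) (hb : 0 ≤ b) (hab : a + b = 1) :
    tpow 1 0 (a • P + b • Q).1 (a • P + b • Q).2 = a • tpow 1 0 P.1 P.2 + b • tpow 1 0 Q.1 Q.2 := by
  have hR := convex_posPairs hP hQ ha hb hab
  rw [tpow_one_zero hP.1 hP.2, tpow_one_zero hQ.1 hQ.2, tpow_one_zero hR.1 hR.2]
  simp [Matrix.add_kronecker, Matrix.smul_kronecker]

lemma tpow_zero_one_comb {P Q : Matrix m m ℂ × Matrix n n ℂ} (hP : P ∈ posPairs m n)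
    (hQ : Q ∈ posPairs m n) {a b : ℝ} (ha : 0 ≤ a) (hb : 0 ≤ b) (hab : a + b = 1) :
    tpow 0 1 (a • P + b • Q).1 (a • P + b • Q).2 = a • tpow 0 1 P.1 P.2 + b • tpow 0 1 Q.1 Q.2 := by
  have hR := convex_posPairs hP hQ ha hb hab
  rw [tpow_zero_one hP.1 hP.2, tpow_zero_one hQ.1 hQ.2, tpow_zero_one hR.1 hR.2]
  simp [Matrix.kronecker_add, Matrix.kronecker_smul]

lemma continuous_tpow {A : Matrix m m ℂ} {B : Matrix n n ℂ} (hA : A.PosDef) (hB : B.PosDef) :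
    Continuous fun p : ℝ => tpow p (1 - p) A B := by
  have h1 := continuous_rpow hA
  have h2 : Continuous fun p : ℝ => B ^ (1 - p) :=
    (continuous_rpow hB).comp (continuous_const.sub continuous_id)
  refine continuous_matrix fun i j => ?_
  exact (h1.matrix_elem i.1 j.1).mul (h2.matrix_elem i.2 j.2)

omit [DecidableEq m] in
lemma isClosed_posSemidef : IsClosed {M : Matrix m m ℂ | M.PosSemidef} := by
  simp only [Matrix.posSemidef_iff_dotProduct_mulVec, Set.ofPred_and, Set.ofPred_forall,
    Matrix.IsHermitian]
  refine (isClosed_eq (by fun_prop) continuous_id).inter (isClosed_iInter fun x => ?_)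
  exact isClosed_le continuous_const
    (continuous_const.dotProduct (continuous_id.matrix_mulVec continuous_const))

/-- For fixed points and weights, the concavity inequality is the preimage of the closed positive
semidefinite cone under a map continuous in `p`. -/
lemma isClosed_jointlyConcave_tpow :
    IsClosed {p : ℝ | JointlyConcave (tpow (m := m) (n := n) p (1 - p))} := by
  have : {p : ℝ | JointlyConcave (tpow (m := m) (n := n) p (1 - p))} =
      ⋂ (P ∈ posPairs m n) (Q ∈ posPairs m n) (a : ℝ) (b : ℝ) (_ : 0 ≤ a) (_ : 0 ≤ b)
        (_ : a + b = 1), {p : ℝ | (tpow p (1 - p) (a • P + b • Q).1 (a • P + b • Q).2 -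
          (a • tpow p (1 - p) P.1 P.2 + b • tpow p (1 - p) Q.1 Q.2)).PosSemidef} := by
    ext p
    simp only [Set.mem_ofPred_eq, Set.mem_iInter]
    exact ⟨fun h P hP Q hQ a b ha hb hab => h.2 hP hQ ha hb hab,
      fun h => ⟨convex_posPairs, fun P hP Q hQ a b ha hb hab => h P hP Q hQ a b ha hb hab⟩⟩
  rw [this]
  refine isClosed_biInter fun P hP => isClosed_biInter fun Q hQ => isClosed_iInter fun a =>
    isClosed_iInter fun b => isClosed_iInter fun ha => isClosed_iInter fun hb =>
    isClosed_iInter fun hab => ?_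
  have hR := convex_posPairs hP hQ ha hb hab
  exact isClosed_posSemidef.preimage ((continuous_tpow hR.1 hR.2).sub
    (((continuous_tpow hP.1 hP.2).const_smul a).add ((continuous_tpow hQ.1 hQ.2).const_smul b)))

/-- Let `c ≤ t ≤ d` be the points of `S` in `[a, b]` nearest to `t` on either side. Their midpoint
lies in `S`, so it cannot fall strictly between them; this forces `c = d = t`. -/
lemma Icc_subset_of_isClosed_of_midpoint {S : Set ℝ} (hS : IsClosed S) {a b : ℝ} (ha : a ∈ S)
    (hb : b ∈ S) (hmid : ∀ p ∈ S, ∀ q ∈ S, (p + q) / 2 ∈ S) : Set.Icc a b ⊆ S := by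
  intro t ht
  have hne1 : (S ∩ Set.Icc a t).Nonempty := ⟨a, ha, le_refl a, ht.1⟩
  have hne2 : (S ∩ Set.Icc t b).Nonempty := ⟨b, hb, ht.2, le_refl b⟩
  have hb1 : BddAbove (S ∩ Set.Icc a t) := ⟨t, fun x hx => hx.2.2⟩
  have hb2 : BddBelow (S ∩ Set.Icc t b) := ⟨t, fun x hx => hx.2.1⟩
  have hc := (hS.inter isClosed_Icc).csSup_mem hne1 hb1
  have hd := (hS.inter isClosed_Icc).csInf_mem hne2 hb2
  set c := sSup (S ∩ Set.Icc a t)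
  set d := sInf (S ∩ Set.Icc t b)
  have hm := hmid c hc.1 d hd.1
  rcases le_total ((c + d) / 2) t with hle | hle
  · have h1 := le_csSup hb1 ⟨hm, by linarith [hc.2.1, hd.2.1, hc.2.2], hle⟩
    have : t = d := by linarith [hd.2.1, hc.2.2]
    exact this ▸ hd.1
  · have h1 := csInf_le hb2 ⟨hm, hle, by linarith [hc.2.2, hd.2.2, ht.2]⟩
    have : t = c := by linarith [hd.2.1, hc.2.2]
    exact this ▸ hc.1

/-- Joint operator concavity of `A^p ⊗ B^(1-p)` for `p ∈ [0, 1]`. -/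
theorem jointlyConcave_tpow {p : ℝ} (hp : p ∈ Set.Icc (0 : ℝ) 1) :
    JointlyConcave (tpow (m := m) (n := n) p (1 - p)) := by
  refine Icc_subset_of_isClosed_of_midpoint isClosed_jointlyConcave_tpow ?_ ?_
    (fun p hp q hq => jointlyConcave_tpow_midpoint hp hq) hp
  · refine ⟨convex_posPairs, fun P hP Q hQ a b ha hb hab => ?_⟩
    rw [sub_zero]
    exact (tpow_zero_one_comb hP hQ ha hb hab).ge
  · refine ⟨convex_posPairs, fun P hP Q hQ a b ha hb hab => ?_⟩
    rw [sub_self]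
    exact (tpow_one_zero_comb hP hQ ha hb hab).ge

/-- If `W = A^s ⊗ B^t` is jointly concave and `X = A^u ⊗ B^v` is jointly affine, then
`X W⁻¹ X` is jointly convex. -/
lemma jointlyConvex_tpow_of_schur {s t u v : ℝ}
    (hW : JointlyConcave (tpow (m := m) (n := n) s t))
    (hX : ∀ P ∈ posPairs m n, ∀ Q ∈ posPairs m n, ∀ a b : ℝ, 0 ≤ a → 0 ≤ b → a + b = 1 →
      tpow u v (a • P + b • Q).1 (a • P + b • Q).2 = a • tpow u v P.1 P.2 + b • tpow u v Q.1 Q.2) :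
    JointlyConvex (tpow (m := m) (n := n) (2 * u - s) (2 * v - t)) := by
  refine ⟨convex_posPairs, fun P hP Q hQ a b ha hb hab => ?_⟩
  have hR := convex_posPairs hP hQ ha hb hab
  -- Average the blocks with entries `W`, `X`, `X W⁻¹ X`: concavity enlarges the corner `W`, the
  -- off-diagonal `X` is affine, and the Schur complement of the result is the convexity inequality.
  have h := posSemidef_fromBlocks_convexComb (posSemidef_fromBlocks_tpow hP.1 hP.2 s t u v)
    (posSemidef_fromBlocks_tpow hQ.1 hQ.2 s t u v) ha hb (hW.2 hP hQ ha hb hab) le_rfl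
  rw [← hX P hP Q hQ a b ha hb hab] at h
  have hPD := posDef_tpow hR.1 hR.2 s t
  have hG := (posDef_tpow hR.1 hR.2 u v).1
  have : Invertible (tpow s t (a • P + b • Q).1 (a • P + b • Q).2) := hPD.isUnit.invertible
  have h' := (Matrix.PosDef.fromBlocks₁₁ (tpow u v (a • P + b • Q).1 (a • P + b • Q).2)
    (a • tpow (2 * u - s) (2 * v - t) P.1 P.2 + b • tpow (2 * u - s) (2 * v - t) Q.1 Q.2) hPD).1
  rw [hG.eq, schur_tpow hR.1 hR.2] at h'
  exact h' h

/-- Joint operator convexity of `A^p ⊗ B^(1-p)` for `p ∈ [-1, 0] ∪ [1, 2]`. -/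
theorem jointlyConvex_tpow {p : ℝ} (hp : p ∈ Set.Icc (-1 : ℝ) 0 ∪ Set.Icc (1 : ℝ) 2) :
    JointlyConvex (tpow (m := m) (n := n) p (1 - p)) := by
  rcases hp with hp | hp
  -- Here `X = I ⊗ B` and `W` has exponent `-p ∈ [0, 1]`; in the other case `X = A ⊗ I` and `W` has
  -- exponent `2 - p`.
  · have h := jointlyConvex_tpow_of_schur (u := 0) (v := 1)
      (jointlyConcave_tpow (m := m) (n := n) (p := -p) ⟨by linarith [hp.2], by linarith [hp.1]⟩)
      fun P hP Q hQ a b => tpow_zero_one_comb hP hQ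
    convert h using 2 <;> ring
  · have h := jointlyConvex_tpow_of_schur (u := 1) (v := 0)
      (jointlyConcave_tpow (m := m) (n := n) (p := 2 - p) ⟨by linarith [hp.2], by linarith [hp.1]⟩)
      fun P hP Q hQ a b => tpow_one_zero_comb hP hQ
    convert h using 2 <;> ring

end Core

/-! ### Perspectives as differences of tensor powers. -/

section Perspective

variable {m n : Type*} [Fintype m] [DecidableEq m] [Fintype n] [DecidableEq n]

lemma cfc_const_mul_sub_rpow {M : Matrix m m ℂ} (hM : M.PosDef) (c s p : ℝ) :
    cfc (fun x : ℝ => c * (x ^ s - x ^ p)) M = c • (M ^ s - M ^ p) := by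
  obtain ⟨U, d, hd, rfl⟩ := exists_eq_conjDiag hM
  rw [cfc_conjDiag, rpow_conjDiag U hd, rpow_conjDiag U hd, ← map_sub, ← map_smul]
  congr 1
  funext i
  simp

lemma rpow_rpow {A : Matrix m m ℂ} (hA : A.PosDef) (p q : ℝ) : (A ^ p) ^ q = A ^ (p * q) := by
  obtain ⟨U, d, hd, rfl⟩ := exists_eq_conjDiag hA
  rw [rpow_conjDiag U hd, rpow_conjDiag U hd,
    rpow_conjDiag U fun i => Real.rpow_pos_of_pos (hd i) p]
  simp only [Real.rpow_mul (hd _).le]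

lemma rpow_neg_one {A : Matrix m m ℂ} (hA : A.PosDef) : A ^ (-1 : ℝ) = A⁻¹ := by
  refine (Matrix.inv_eq_right_inv ?_).symm
  nth_rw 1 [← rpow_one hA]
  rw [← rpow_add hA, add_neg_cancel, rpow_zero hA]

/-- The perspective of `c (x^s - x^p)`. -/
lemma one_kronecker_mul_cfc {A : Matrix m m ℂ} {B : Matrix n n ℂ} (hA : A.PosDef) (hB : B.PosDef)
    (c s p : ℝ) : ((1 : Matrix m m ℂ) ⊗ₖ B) * cfc (fun x : ℝ => c * (x ^ s - x ^ p)) (A ⊗ₖ B⁻¹) =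
      c • (tpow s (1 - s) A B - tpow p (1 - p) A B) := by
  have key : ∀ r : ℝ, ((1 : Matrix m m ℂ) ⊗ₖ B) * (A ⊗ₖ B⁻¹) ^ r = tpow r (1 - r) A B := by
    intro r
    rw [kronecker_rpow hA hB.inv, ← rpow_neg_one hB, rpow_rpow hB, ← tpow_zero_one hA hB]
    change tpow 0 1 A B * tpow r (-1 * r) A B = _
    rw [tpow_mul hA hB]
    congr 1 <;> ring
  rw [cfc_const_mul_sub_rpow (hA.kronecker hB.inv), Matrix.mul_smul, mul_sub, key, key]

lemma perspective_g_eq {A : Matrix m m ℂ} {B : Matrix n n ℂ} (hA : A.PosDef) (hB : B.PosDef)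
    {p : ℝ} (hp : p ≠ 1) : perspective (g p) A B =
      (1 / (1 - p)) • (tpow 1 0 A (B.map star) - tpow p (1 - p) A (B.map star)) := by
  have h := one_kronecker_mul_cfc hA (posDef_map_star hB) (1 / (1 - p)) 1 p
  rw [sub_self] at h
  rw [← h, perspective]
  congr 2
  funext x
  simp [g, hp]

lemma perspective_h_eq {A : Matrix m m ℂ} {B : Matrix n n ℂ} (hA : A.PosDef) (hB : B.PosDef)
    {q : ℝ} (hq : q ≠ 0) : perspective (h q) A B =
      (1 / q) • (tpow 0 1 A (B.map star) - tpow q (1 - q) A (B.map star)) := by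
  -- The constant `1` in `h q` is taken as `x ^ 0`.
  have h := one_kronecker_mul_cfc hA (posDef_map_star hB) (1 / q) 0 q
  rw [sub_zero] at h
  rw [← h, perspective]
  congr 2
  funext x
  simp [LiebAndo.h, hq]

end Perspective

/-! ### Joint convexity of the operator expressions. -/

section JointConvexity

variable {m n : Type*} [Fintype m] [DecidableEq m] [Fintype n] [DecidableEq n]

omit [Fintype m] [DecidableEq m] [Fintype n] [DecidableEq n] in
lemma JointlyConvex.congr {β : Type*} [AddCommMonoid β] [PartialOrder β] [SMul ℝ β]
    {F G : Matrix m m ℂ → Matrix n n ℂ → β} (hF : JointlyConvex F)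
    (h : ∀ A B, A.PosDef → B.PosDef → F A B = G A B) : JointlyConvex G :=
  ConvexOn.congr hF fun P hP => h P.1 P.2 hP.1 hP.2

omit [Fintype m] [DecidableEq m] [Fintype n] [DecidableEq n] in
lemma JointlyConcave.congr {β : Type*} [AddCommMonoid β] [PartialOrder β] [SMul ℝ β]
    {F G : Matrix m m ℂ → Matrix n n ℂ → β} (hF : JointlyConcave F)
    (h : ∀ A B, A.PosDef → B.PosDef → F A B = G A B) : JointlyConcave G :=
  ConcaveOn.congr hF fun P hP => h P.1 P.2 hP.1 hP.2

omit [Fintype m] [DecidableEq m] in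
-- Entrywise conjugation is real-linear and preserves positive definiteness.
lemma JointlyConvex.comp_map_star {β : Type*} [AddCommMonoid β] [PartialOrder β] [SMul ℝ β]
    {F : Matrix m m ℂ → Matrix n n ℂ → β} (hF : JointlyConvex F) :
    JointlyConvex fun A B => F A (B.map star) := by
  refine ⟨convex_posPairs, fun P hP Q hQ a b ha hb hab => ?_⟩
  have h := hF.2 (x := (P.1, P.2.map star)) ⟨hP.1, posDef_map_star hP.2⟩
    (y := (Q.1, Q.2.map star)) ⟨hQ.1, posDef_map_star hQ.2⟩ ha hb hab
  have e : (a • P.2 + b • Q.2).map star = a • P.2.map star + b • Q.2.map star := by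
    ext i j; simp
  change F (a • P.1 + b • Q.1) ((a • P.2 + b • Q.2).map star) ≤ _
  rw [e]
  exact h

omit [Fintype m] [DecidableEq m] [Fintype n] [DecidableEq n] in
lemma JointlyConvex.smul_sub {β : Type*} [AddCommGroup β] [PartialOrder β]
    [IsOrderedAddMonoid β] [Module ℝ β] [PosSMulMono ℝ β] {F G : Matrix m m ℂ → Matrix n n ℂ → β}
    (hF : JointlyConvex F) (hG : JointlyConcave G) {c : ℝ} (hc : 0 ≤ c) :
    JointlyConvex fun A B => c • (F A B - G A B) :=
  (ConvexOn.sub hF hG).smul hc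

omit [Fintype m] [DecidableEq m] [Fintype n] [DecidableEq n] in
lemma JointlyConvex.neg_mul {F : Matrix m m ℂ → Matrix n n ℂ → ℝ} (hF : JointlyConvex F) {c : ℝ}
    (hc : 0 ≤ c) : JointlyConcave fun A B => -(c * F A B) :=
  (ConvexOn.smul hc hF).neg

/-- The linear term is both convex and concave. As `p` crosses `1`, the power turns from concave to
convex while `1 - p` changes sign, so the quotient stays convex. -/
lemma jointlyConvex_g_tpow {p : ℝ} (hp : p ∈ Set.Ioo (0 : ℝ) 1 ∪ Set.Ioc (1 : ℝ) 2) :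
    JointlyConvex fun (A : Matrix m m ℂ) (B : Matrix n n ℂ) =>
      (1 / (1 - p)) • (tpow 1 0 A B - tpow p (1 - p) A B) := by
  rcases hp with hp | hp
  · have h1 := jointlyConvex_tpow (m := m) (n := n) (p := 1) (Or.inr ⟨le_rfl, one_le_two⟩)
    have h2 := jointlyConcave_tpow (m := m) (n := n) (Set.Ioo_subset_Icc_self hp)
    rw [sub_self] at h1
    exact h1.smul_sub h2 (one_div_nonneg.2 (by linarith [hp.2]))
  · have h1 := jointlyConcave_tpow (m := m) (n := n) (p := 1) ⟨zero_le_one, le_rfl⟩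
    have h2 := jointlyConvex_tpow (m := m) (n := n) (Or.inr (Set.Ioc_subset_Icc_self hp))
    rw [sub_self] at h1
    refine (h2.smul_sub h1 (one_div_nonneg.2 (sub_nonneg.2 hp.1.le))).congr fun A B _ _ => ?_
    have : 1 / (p - 1) = -(1 / (1 - p)) := by rw [← neg_sub, one_div_neg_eq_neg_one_div]
    rw [this, neg_smul, ← smul_neg, neg_sub]

lemma jointlyConvex_h_tpow {q : ℝ} (hq : q ∈ Set.Ico (-1 : ℝ) 0 ∪ Set.Ioo (0 : ℝ) 1) :
    JointlyConvex fun (A : Matrix m m ℂ) (B : Matrix n n ℂ) =>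
      (1 / q) • (tpow 0 1 A B - tpow q (1 - q) A B) := by
  rcases hq with hq | hq
  · have h1 := jointlyConcave_tpow (m := m) (n := n) (p := 0) ⟨le_rfl, zero_le_one⟩
    have h2 := jointlyConvex_tpow (m := m) (n := n) (Or.inl (Set.Ico_subset_Icc_self hq))
    rw [sub_zero] at h1
    refine (h2.smul_sub h1 (one_div_nonneg.2 (neg_nonneg.2 hq.2.le))).congr fun A B _ _ => ?_
    rw [one_div_neg_eq_neg_one_div, neg_smul, ← smul_neg, neg_sub]
  · have h1 := jointlyConvex_tpow (m := m) (n := n) (p := 0) (Or.inl ⟨by norm_num, le_rfl⟩)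
    have h2 := jointlyConcave_tpow (m := m) (n := n) (Set.Ioo_subset_Icc_self hq)
    rw [sub_zero] at h1
    exact h1.smul_sub h2 (one_div_nonneg.2 hq.1.le)

end JointConvexity

/-! ### Trace functionals and their limits at `p = 0, 1`. -/

section Trace

variable {m n : Type*} [Fintype m] [DecidableEq m] [Fintype n] [DecidableEq n]

/-- The real part of the quadratic form of a matrix on `m × n` at the vectorization of `K`. -/
noncomputable def vecForm (K : Matrix m n ℂ) : Matrix (m × n) (m × n) ℂ →ₗ[ℝ] ℝ where
  toFun M := (star (fun i : m × n => K i.1 i.2) ⬝ᵥ (M *ᵥ fun i : m × n => K i.1 i.2)).re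
  map_add' M N := by simp [Matrix.add_mulVec, dotProduct_add]
  map_smul' c M := by simp [Matrix.smul_mulVec, dotProduct_smul]

omit [DecidableEq m] [DecidableEq n] in
lemma vecForm_mono (K : Matrix m n ℂ) {M N : Matrix (m × n) (m × n) ℂ} (h : M ≤ N) :
    vecForm K M ≤ vecForm K N := by
  rw [← sub_nonneg, ← map_sub]
  exact (Matrix.le_iff.1 h).re_dotProduct_nonneg _

omit [DecidableEq m] [DecidableEq n] in
-- For Hermitian `Y` the conjugate is the transpose, and `X ⊗ Yᵀ` sends the vectorization of `K` to
-- that of `X K Y`. This is why `B̄` occurs in the operator form.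
lemma vecForm_kronecker (K : Matrix m n ℂ) (X : Matrix m m ℂ) {Y : Matrix n n ℂ}
    (hY : Y.IsHermitian) : vecForm K (X ⊗ₖ Y.map star) = (Kᴴ * X * K * Y).trace.re := by
  have hY' : ∀ i j, star (Y i j) = Y j i := fun i j => hY.apply j i
  have hmul : (X ⊗ₖ Y.map star) *ᵥ (fun i : m × n => K i.1 i.2) =
      fun i => (X * K * Y) i.1 i.2 := by
    funext i
    simp only [Matrix.mulVec, dotProduct, Matrix.mul_apply, Matrix.kroneckerMap_apply,
      Matrix.map_apply, hY', Fintype.sum_prod_type, Finset.sum_mul]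
    rw [Finset.sum_comm]
    exact Finset.sum_congr rfl fun _ _ => Finset.sum_congr rfl fun _ _ => by ring
  change Complex.re _ = _
  have htr : (Kᴴ * X * K * Y).trace = (Kᴴ * (X * K * Y)).trace := by
    simp only [Matrix.mul_assoc]
  rw [hmul, htr]
  simp only [dotProduct, Matrix.trace, Matrix.diag_apply, Matrix.mul_apply (M := Kᴴ),
    Matrix.conjTranspose_apply, Fintype.sum_prod_type, Pi.star_apply]
  rw [Finset.sum_comm]

lemma vecForm_tpow (K : Matrix m n ℂ) {A : Matrix m m ℂ} {B : Matrix n n ℂ} (hB : B.PosDef)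
    (p : ℝ) : vecForm K (tpow p (1 - p) A (B.map star)) = (liebTrace K p A B).re := by
  rw [tpow, map_star_rpow hB, vecForm_kronecker K _ (posDef_rpow hB _).1, liebTrace]

omit [DecidableEq m] [DecidableEq n] in
lemma JointlyConvex.vecForm {F : Matrix m m ℂ → Matrix n n ℂ → Matrix (m × n) (m × n) ℂ}
    (hF : JointlyConvex F) (K : Matrix m n ℂ) : JointlyConvex fun A B => vecForm K (F A B) := by
  refine ⟨convex_posPairs, fun P hP Q hQ a b ha hb hab => ?_⟩
  have h := vecForm_mono K (hF.2 hP hQ ha hb hab)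
  simpa only [map_add, map_smul] using h

lemma liebTrace_one (K : Matrix m n ℂ) {A : Matrix m m ℂ} {B : Matrix n n ℂ} (hA : A.PosDef)
    (hB : B.PosDef) : liebTrace K 1 A B = (Kᴴ * A * K).trace := by
  rw [liebTrace, sub_self, rpow_one hA, rpow_zero hB, mul_one]

lemma liebTrace_zero (K : Matrix m n ℂ) {A : Matrix m m ℂ} {B : Matrix n n ℂ} (hA : A.PosDef)
    (hB : B.PosDef) : liebTrace K 0 A B = (Kᴴ * K * B).trace := by
  rw [liebTrace, sub_zero, rpow_zero hA, rpow_one hB, Matrix.mul_one]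

lemma jointlyConvex_g_liebTrace (K : Matrix m n ℂ) {p : ℝ}
    (hp : p ∈ Set.Ioo (0 : ℝ) 1 ∪ Set.Ioc (1 : ℝ) 2) :
    JointlyConvex fun (A : Matrix m m ℂ) (B : Matrix n n ℂ) =>
      1 / (1 - p) * ((liebTrace K 1 A B).re - (liebTrace K p A B).re) := by
  refine ((jointlyConvex_g_tpow hp).comp_map_star.vecForm K).congr fun A B _ hB => ?_
  rw [map_smul, map_sub, ← vecForm_tpow K hB, ← vecForm_tpow K hB, sub_self, smul_eq_mul]

lemma jointlyConvex_h_liebTrace (K : Matrix m n ℂ) {q : ℝ}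
    (hq : q ∈ Set.Ico (-1 : ℝ) 0 ∪ Set.Ioo (0 : ℝ) 1) :
    JointlyConvex fun (A : Matrix m m ℂ) (B : Matrix n n ℂ) =>
      1 / q * ((liebTrace K 0 A B).re - (liebTrace K q A B).re) := by
  refine ((jointlyConvex_h_tpow hq).comp_map_star.vecForm K).congr fun A B _ hB => ?_
  rw [map_smul, map_sub, ← vecForm_tpow K hB, ← vecForm_tpow K hB, sub_zero, smul_eq_mul]

lemma jointlyConvex_liebTrace (K : Matrix m n ℂ) {p : ℝ}
    (hp : p ∈ Set.Icc (-1 : ℝ) 0 ∪ Set.Icc (1 : ℝ) 2) :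
    JointlyConvex fun (A : Matrix m m ℂ) (B : Matrix n n ℂ) => (liebTrace K p A B).re :=
  ((jointlyConvex_tpow hp).comp_map_star.vecForm K).congr fun _ _ _ hB => vecForm_tpow K hB p

lemma jointlyConcave_liebTrace (K : Matrix m n ℂ) {p : ℝ} (hp : p ∈ Set.Icc (0 : ℝ) 1) :
    JointlyConcave fun (A : Matrix m m ℂ) (B : Matrix n n ℂ) => (liebTrace K p A B).re := by
  have h1 : JointlyConvex fun (A : Matrix m m ℂ) (B : Matrix n n ℂ) => -tpow p (1 - p) A B :=
    ConcaveOn.neg (jointlyConcave_tpow hp)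
  have h2 : JointlyConvex fun (A : Matrix m m ℂ) (B : Matrix n n ℂ) => -(liebTrace K p A B).re :=
    (h1.comp_map_star.vecForm K).congr fun A B _ hB => by rw [map_neg, vecForm_tpow K hB]
  exact neg_convexOn_iff.1 h2

lemma jointlyConcave_liebTrace_div (K : Matrix m n ℂ) {p : ℝ} (hp : p ∈ Set.Icc (-1 : ℝ) 2) :
    JointlyConcave fun (A : Matrix m m ℂ) (B : Matrix n n ℂ) =>
      1 / (p * (1 - p)) * (liebTrace K p A B).re := by
  by_cases h : p ∈ Set.Icc (0 : ℝ) 1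
  -- At `p = 0` and `p = 1` the factor is `1 / 0 = 0`, so the endpoints need no separate treatment.
  · exact (jointlyConcave_liebTrace K h).smul
      (one_div_nonneg.2 (mul_nonneg h.1 (sub_nonneg.2 h.2)))
  · have hp' : p < 0 ∨ 1 < p := by
      by_contra! hc
      exact h hc
    have hmem : p ∈ Set.Icc (-1 : ℝ) 0 ∪ Set.Icc (1 : ℝ) 2 :=
      hp'.imp (fun h => ⟨hp.1, h.le⟩) fun h => ⟨h.le, hp.2⟩
    have hneg : p * (1 - p) ≤ 0 := by rcases hp' with h | h <;> nlinarith
    refine ((jointlyConvex_liebTrace K hmem).neg_mul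
      (neg_nonneg.2 (one_div_nonpos.2 hneg))).congr fun A B _ _ => ?_
    rw [neg_mul, neg_neg]

omit [Fintype m] [DecidableEq m] [Fintype n] [DecidableEq n] in
lemma JointlyConcave.of_tendsto {l : Filter ℝ} [l.NeBot]
    {F : ℝ → Matrix m m ℂ → Matrix n n ℂ → ℝ} {G : Matrix m m ℂ → Matrix n n ℂ → ℝ}
    (hF : ∀ᶠ p in l, JointlyConcave (F p))
    (hG : ∀ A B, A.PosDef → B.PosDef → Filter.Tendsto (fun p => F p A B) l (𝓝 (G A B))) :
    JointlyConcave G := by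
  refine ⟨convex_posPairs, fun P hP Q hQ a b ha hb hab => ?_⟩
  have hR := convex_posPairs hP hQ ha hb hab
  refine le_of_tendsto_of_tendsto (((hG _ _ hP.1 hP.2).const_smul a).add
    ((hG _ _ hQ.1 hQ.2).const_smul b)) (hG _ _ hR.1 hR.2) ?_
  filter_upwards [hF] with p hp
  exact hp.2 hP hQ ha hb hab

/-- `Tr K* A^p K B^(1-p)` is a real differentiable function of `p`; its derivative is expressed
through matrix logarithms at `p = 0` and `p = 1`. -/
lemma exists_hasDerivAt_liebTrace (K : Matrix m n ℂ) {A : Matrix m m ℂ} {B : Matrix n n ℂ}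
    (hA : A.PosDef) (hB : B.PosDef) : ∃ f f' : ℝ → ℝ,
      (∀ p, liebTrace K p A B = (f p : ℂ)) ∧ (∀ p, HasDerivAt f (f' p) p) ∧
      (Kᴴ * (A * matLog A) * K - Kᴴ * A * K * matLog B).trace = (f' 1 : ℂ) ∧
      (Kᴴ * K * (B * matLog B) - Kᴴ * matLog A * K * B).trace = ((-f' 0 : ℝ) : ℂ) := by
  obtain ⟨U, a, ha, rfl⟩ := exists_eq_conjDiag hA
  obtain ⟨V, b, hb, rfl⟩ := exists_eq_conjDiag hB
  set w : m → n → ℝ := fun i j =>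
    Complex.normSq (((U : Matrix m m ℂ)ᴴ * K * (V : Matrix n n ℂ)) i j)
  have htr : ∀ x y, (Kᴴ * conjDiag U x * K * conjDiag V y).trace =
      ∑ j, ∑ i, (w i j : ℂ) * (x i * y j) := trace_conjDiag K U V
  -- At `p = 1` the summand of the derivative has the factor `a log a - a log b`; at `p = 0` it has
  -- `b log a - b log b`, which accounts for the sign in front of `f' 0`.
  refine ⟨fun p => ∑ j, ∑ i, w i j * (a i ^ p * b j ^ (1 - p)),
    fun p => ∑ j, ∑ i, w i j * (a i ^ p * b j ^ (1 - p) * (Real.log (a i) - Real.log (b j))),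
    fun p => ?_, fun p => ?_, ?_, ?_⟩
  · rw [liebTrace, rpow_conjDiag U ha, rpow_conjDiag V hb, htr]
    push_cast
    rfl
  · refine HasDerivAt.fun_sum fun j _ => HasDerivAt.fun_sum fun i _ => HasDerivAt.const_mul _ ?_
    have h1 := Real.hasStrictDerivAt_const_rpow (ha i) p |>.hasDerivAt
    have h2 := (Real.hasStrictDerivAt_const_rpow (hb j) (1 - p)).hasDerivAt.comp p
      ((hasDerivAt_id p).const_sub 1)
    refine (h1.mul h2).congr_deriv ?_
    simp only [Function.comp_apply]
    ring
  · have h1 : conjDiag U (fun i => (a i : ℂ)) * matLog (conjDiag U fun i => (a i : ℂ)) =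
        conjDiag U fun i => (a i : ℂ) * (Real.log (a i) : ℂ) := by
      rw [matLog, cfc_conjDiag, ← map_mul]; rfl
    have h2 := htr (fun i => (a i : ℂ) * (Real.log (a i) : ℂ)) 1
    rw [map_one, mul_one] at h2
    rw [Matrix.trace_sub, h1, h2, matLog, cfc_conjDiag, htr, ← Finset.sum_sub_distrib]
    push_cast
    refine Finset.sum_congr rfl fun j _ => ?_
    rw [← Finset.sum_sub_distrib]
    refine Finset.sum_congr rfl fun i _ => ?_
    simp
    ring
  · have h1 : conjDiag V (fun i => (b i : ℂ)) * matLog (conjDiag V fun i => (b i : ℂ)) =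
        conjDiag V fun i => (b i : ℂ) * (Real.log (b i) : ℂ) := by
      rw [matLog, cfc_conjDiag, ← map_mul]; rfl
    have h2 := htr 1 (fun i => (b i : ℂ) * (Real.log (b i) : ℂ))
    rw [map_one, Matrix.mul_one] at h2
    rw [Matrix.trace_sub, h1, h2, matLog, cfc_conjDiag, htr, ← Finset.sum_sub_distrib]
    push_cast
    rw [← Finset.sum_neg_distrib]
    refine Finset.sum_congr rfl fun j _ => ?_
    rw [← Finset.sum_sub_distrib, ← Finset.sum_neg_distrib]
    refine Finset.sum_congr rfl fun i _ => ?_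
    simp
    ring

lemma liebTrace_im (K : Matrix m n ℂ) (p : ℝ) {A : Matrix m m ℂ} {B : Matrix n n ℂ}
    (hA : A.PosDef) (hB : B.PosDef) : (liebTrace K p A B).im = 0 := by
  obtain ⟨f, -, hf, -⟩ := exists_hasDerivAt_liebTrace K hA hB
  rw [hf, Complex.ofReal_im]

/-- The subtracted term is the value of the trace at `p = 1`, so the expression is `-p⁻¹` times a
difference quotient and tends to minus the derivative. -/
lemma tendsto_liebTrace_one (K : Matrix m n ℂ) {A : Matrix m m ℂ} {B : Matrix n n ℂ}
    (hA : A.PosDef) (hB : B.PosDef) :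
    Filter.Tendsto (fun p : ℝ => (1 / (p * (1 - p))) •
        (liebTrace K p A B - (Kᴴ * A * K).trace)) (𝓝[≠] 1)
      (𝓝 (-(Kᴴ * (A * matLog A) * K - Kᴴ * A * K * matLog B).trace)) := by
  obtain ⟨f, f', hf, hf', h1, -⟩ := exists_hasDerivAt_liebTrace K hA hB
  have hs := (hasDerivAt_iff_tendsto_slope.1 (hf' 1))
  have hi : Filter.Tendsto (fun p : ℝ => -p⁻¹) (𝓝[≠] 1) (𝓝 (-1)) := by
    have : Filter.Tendsto (fun p : ℝ => -p⁻¹) (𝓝 1) (𝓝 (-1⁻¹)) :=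
      (tendsto_inv₀ one_ne_zero).neg
    rw [inv_one] at this
    exact this.mono_left nhdsWithin_le_nhds
  have h := (Complex.continuous_ofReal.tendsto _).comp (hi.mul hs)
  rw [h1, ← Complex.ofReal_neg, ← neg_one_mul (f' 1)]
  refine h.congr fun p => ?_
  rw [← liebTrace_one K hA hB, hf, hf, Function.comp_apply, slope_def_field, ← Complex.ofReal_sub,
    ← Complex.coe_smul, smul_eq_mul, ← Complex.ofReal_mul]
  congr 1
  rw [← neg_sub p 1, mul_neg, one_div, inv_neg, mul_inv]
  ring

lemma tendsto_liebTrace_zero (K : Matrix m n ℂ) {A : Matrix m m ℂ} {B : Matrix n n ℂ}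
    (hA : A.PosDef) (hB : B.PosDef) :
    Filter.Tendsto (fun p : ℝ => (1 / (p * (1 - p))) •
        (liebTrace K p A B - (Kᴴ * K * B).trace)) (𝓝[≠] 0)
      (𝓝 (-(Kᴴ * K * (B * matLog B) - Kᴴ * matLog A * K * B).trace)) := by
  obtain ⟨f, f', hf, hf', -, h1⟩ := exists_hasDerivAt_liebTrace K hA hB
  have hs := (hasDerivAt_iff_tendsto_slope.1 (hf' 0))
  have hi : Filter.Tendsto (fun p : ℝ => (1 - p)⁻¹) (𝓝[≠] 0) (𝓝 1) := by
    have : Filter.Tendsto (fun p : ℝ => (1 - p)⁻¹) (𝓝 0) (𝓝 ((1 - 0)⁻¹)) :=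
      (tendsto_const_nhds.sub Filter.tendsto_id).inv₀ (by norm_num)
    rw [sub_zero, inv_one] at this
    exact this.mono_left nhdsWithin_le_nhds
  have h := (Complex.continuous_ofReal.tendsto _).comp (hi.mul hs)
  rw [h1, ← Complex.ofReal_neg, neg_neg, ← one_mul (f' 0)]
  refine h.congr fun p => ?_
  rw [← liebTrace_zero K hA hB, hf, hf, Function.comp_apply, slope_def_field, ← Complex.ofReal_sub,
    ← Complex.coe_smul, smul_eq_mul, ← Complex.ofReal_mul]
  congr 1
  rw [one_div, mul_inv, sub_zero]
  ring

/-- For `p` near `1` the approximating expression is `-(1 / p)` times the convex trace function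
attached to `g p`, hence concave; near `0` the analogue is `-(1 / (1 - p))` times the one attached
to `h p`. -/
lemma jointlyConcave_limit_one (K : Matrix m n ℂ) :
    JointlyConcave fun (A : Matrix m m ℂ) (B : Matrix n n ℂ) =>
      (-(Kᴴ * (A * matLog A) * K - Kᴴ * A * K * matLog B).trace).re := by
  refine JointlyConcave.of_tendsto (l := 𝓝[≠] (1 : ℝ)) (F := fun p A B => ((1 / (p * (1 - p))) •
        (liebTrace K p A B - (Kᴴ * A * K).trace)).re) ?_ fun A B hA hB =>
    (Complex.continuous_re.tendsto _).comp (tendsto_liebTrace_one K hA hB)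
  filter_upwards [self_mem_nhdsWithin,
    mem_nhdsWithin_of_mem_nhds (Ioo_mem_nhds (zero_lt_one' ℝ) (one_lt_two (α := ℝ)))] with p hp1 hp
  have hmem : p ∈ Set.Ioo (0 : ℝ) 1 ∪ Set.Ioc (1 : ℝ) 2 :=
    (lt_or_gt_of_ne hp1).imp (fun h => ⟨hp.1, h⟩) fun h => ⟨h, hp.2.le⟩
  refine ((jointlyConvex_g_liebTrace K hmem).neg_mul (one_div_nonneg.2 hp.1.le)).congr fun A B hA hB => ?_
  rw [← liebTrace_one K hA hB, Complex.smul_re, Complex.sub_re, one_div, one_div, one_div, mul_inv, smul_eq_mul]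
  ring

lemma jointlyConcave_limit_zero (K : Matrix m n ℂ) :
    JointlyConcave fun (A : Matrix m m ℂ) (B : Matrix n n ℂ) =>
      (-(Kᴴ * K * (B * matLog B) - Kᴴ * matLog A * K * B).trace).re := by
  refine JointlyConcave.of_tendsto (l := 𝓝[≠] (0 : ℝ)) (F := fun p A B => ((1 / (p * (1 - p))) •
        (liebTrace K p A B - (Kᴴ * K * B).trace)).re) ?_ fun A B hA hB =>
    (Complex.continuous_re.tendsto _).comp (tendsto_liebTrace_zero K hA hB)
  filter_upwards [self_mem_nhdsWithin,
    mem_nhdsWithin_of_mem_nhds (Ioo_mem_nhds (neg_one_lt_zero (R := ℝ)) (zero_lt_one' ℝ))]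
    with p hp1 hp
  have hmem : p ∈ Set.Ico (-1 : ℝ) 0 ∪ Set.Ioo (0 : ℝ) 1 :=
    (lt_or_gt_of_ne hp1).imp (fun h => ⟨hp.1.le, h⟩) fun h => ⟨h, hp.2⟩
  refine ((jointlyConvex_h_liebTrace K hmem).neg_mul
    (one_div_nonneg.2 (sub_nonneg.2 hp.2.le))).congr fun A B hA hB => ?_
  rw [← liebTrace_zero K hA hB, Complex.smul_re, Complex.sub_re, one_div, one_div, one_div, mul_inv, smul_eq_mul]
  ring

end Trace

end LiebAndo

theorem mainTheorem3 {m n : Type*} [Fintype m] [DecidableEq m] [Fintype n] [DecidableEq n]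
    (K : Matrix m n ℂ) :
    -- (a), operator form: the formula and joint convexity
    (∀ p : ℝ, p ∈ Set.Ioo (0 : ℝ) 1 ∪ Set.Ioc (1 : ℝ) 2 →
      (∀ (A : Matrix m m ℂ) (B : Matrix n n ℂ), A.PosDef → B.PosDef →
        LiebAndo.perspective (LiebAndo.g p) A B =
          (1 / (1 - p)) • (A ⊗ₖ (1 : Matrix n n ℂ) - (A ^ p) ⊗ₖ ((B.map star) ^ (1 - p)))) ∧
      LiebAndo.JointlyConvex (fun (A : Matrix m m ℂ) (B : Matrix n n ℂ) =>
        LiebAndo.perspective (LiebAndo.g p) A B)) ∧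
    -- (a), trace form: the trace is real and the map is jointly convex
    (∀ p : ℝ, p ∈ Set.Ioo (0 : ℝ) 1 ∪ Set.Ioc (1 : ℝ) 2 →
      (∀ (A : Matrix m m ℂ) (B : Matrix n n ℂ), A.PosDef → B.PosDef →
        (Kᴴ * A * K - Kᴴ * A ^ p * K * B ^ (1 - p)).trace.im = 0) ∧
      LiebAndo.JointlyConvex (fun (A : Matrix m m ℂ) (B : Matrix n n ℂ) =>
        1 / (1 - p) * (Kᴴ * A * K - Kᴴ * A ^ p * K * B ^ (1 - p)).trace.re)) ∧
    -- (c), operator form: the formula and joint convexity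
    (∀ q : ℝ, q ∈ Set.Ico (-1 : ℝ) 0 ∪ Set.Ioo (0 : ℝ) 1 →
      (∀ (A : Matrix m m ℂ) (B : Matrix n n ℂ), A.PosDef → B.PosDef →
        LiebAndo.perspective (LiebAndo.h q) A B =
          (1 / q) • ((1 : Matrix m m ℂ) ⊗ₖ (B.map star)
            - (A ^ q) ⊗ₖ ((B.map star) ^ (1 - q)))) ∧
      LiebAndo.JointlyConvex (fun (A : Matrix m m ℂ) (B : Matrix n n ℂ) =>
        LiebAndo.perspective (LiebAndo.h q) A B)) ∧
    -- (c), trace form: the trace is real and the map is jointly convex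
    (∀ q : ℝ, q ∈ Set.Ico (-1 : ℝ) 0 ∪ Set.Ioo (0 : ℝ) 1 →
      (∀ (A : Matrix m m ℂ) (B : Matrix n n ℂ), A.PosDef → B.PosDef →
        (Kᴴ * K * B - Kᴴ * A ^ q * K * B ^ (1 - q)).trace.im = 0) ∧
      LiebAndo.JointlyConvex (fun (A : Matrix m m ℂ) (B : Matrix n n ℂ) =>
        1 / q * (Kᴴ * K * B - Kᴴ * A ^ q * K * B ^ (1 - q)).trace.re)) ∧
    -- the trace `Tr K* A^p K B^(1-p)` is real, and its multiple by `1 / (p (1 - p))` is jointly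
    -- concave for `p` in `[-1, 2]` other than `0` and `1`
    (∀ (p : ℝ) (A : Matrix m m ℂ) (B : Matrix n n ℂ), A.PosDef → B.PosDef →
      (LiebAndo.liebTrace K p A B).im = 0) ∧
    (∀ p : ℝ, p ∈ Set.Icc (-1 : ℝ) 2 → p ≠ 0 → p ≠ 1 →
      LiebAndo.JointlyConcave (fun (A : Matrix m m ℂ) (B : Matrix n n ℂ) =>
        1 / (p * (1 - p)) * (LiebAndo.liebTrace K p A B).re)) ∧
    -- the extension by continuity at `p = 1`, modulo the linear term `Tr K* A K`
    ((∀ (A : Matrix m m ℂ) (B : Matrix n n ℂ), A.PosDef → B.PosDef →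
        Filter.Tendsto (fun p : ℝ => (1 / (p * (1 - p))) •
            (LiebAndo.liebTrace K p A B - (Kᴴ * A * K).trace)) (𝓝[≠] 1)
          (𝓝 (-(Kᴴ * (A * LiebAndo.matLog A) * K - Kᴴ * A * K * LiebAndo.matLog B).trace))) ∧
      LiebAndo.JointlyConcave (fun (A : Matrix m m ℂ) (B : Matrix n n ℂ) =>
        (-(Kᴴ * (A * LiebAndo.matLog A) * K - Kᴴ * A * K * LiebAndo.matLog B).trace).re)) ∧
    -- the extension by continuity at `p = 0`, modulo the linear term `Tr K* K B`
    ((∀ (A : Matrix m m ℂ) (B : Matrix n n ℂ), A.PosDef → B.PosDef →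
        Filter.Tendsto (fun p : ℝ => (1 / (p * (1 - p))) •
            (LiebAndo.liebTrace K p A B - (Kᴴ * K * B).trace)) (𝓝[≠] 0)
          (𝓝 (-(Kᴴ * K * (B * LiebAndo.matLog B) - Kᴴ * LiebAndo.matLog A * K * B).trace))) ∧
      LiebAndo.JointlyConcave (fun (A : Matrix m m ℂ) (B : Matrix n n ℂ) =>
        (-(Kᴴ * K * (B * LiebAndo.matLog B) - Kᴴ * LiebAndo.matLog A * K * B).trace).re)) ∧
    -- Lieb's concavity theorem
    (∀ p : ℝ, p ∈ Set.Ioo (0 : ℝ) 1 →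
      LiebAndo.JointlyConcave (fun (A : Matrix m m ℂ) (B : Matrix n n ℂ) =>
        (LiebAndo.liebTrace K p A B).re)) ∧
    -- Ando's convexity theorem
    (∀ p : ℝ, p ∈ Set.Icc (1 : ℝ) 2 →
      LiebAndo.JointlyConvex (fun (A : Matrix m m ℂ) (B : Matrix n n ℂ) =>
        (LiebAndo.liebTrace K p A B).re)) := by
  have hg : ∀ {p : ℝ}, p ∈ Set.Ioo (0 : ℝ) 1 ∪ Set.Ioc (1 : ℝ) 2 → p ≠ 1 := fun hp =>
    hp.elim (fun h => h.2.ne) fun h => h.1.ne'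
  have hh : ∀ {q : ℝ}, q ∈ Set.Ico (-1 : ℝ) 0 ∪ Set.Ioo (0 : ℝ) 1 → q ≠ 0 := fun hq =>
    hq.elim (fun h => h.2.ne) fun h => h.1.ne'
  have e1 : ∀ (p : ℝ) (A : Matrix m m ℂ) (B : Matrix n n ℂ), A.PosDef → B.PosDef →
      (Kᴴ * A * K - Kᴴ * A ^ p * K * B ^ (1 - p)).trace =
        LiebAndo.liebTrace K 1 A B - LiebAndo.liebTrace K p A B := fun p A B hA hB => by
    rw [Matrix.trace_sub, LiebAndo.liebTrace_one K hA hB, LiebAndo.liebTrace]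
  have e0 : ∀ (q : ℝ) (A : Matrix m m ℂ) (B : Matrix n n ℂ), A.PosDef → B.PosDef →
      (Kᴴ * K * B - Kᴴ * A ^ q * K * B ^ (1 - q)).trace =
        LiebAndo.liebTrace K 0 A B - LiebAndo.liebTrace K q A B := fun q A B hA hB => by
    rw [Matrix.trace_sub, LiebAndo.liebTrace_zero K hA hB, LiebAndo.liebTrace]
  refine ⟨fun p hp => ⟨fun A B hA hB => ?_, ?_⟩, fun p hp => ⟨fun A B hA hB => ?_, ?_⟩,
    fun q hq => ⟨fun A B hA hB => ?_, ?_⟩, fun q hq => ⟨fun A B hA hB => ?_, ?_⟩,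
    fun p A B hA hB => LiebAndo.liebTrace_im K p hA hB,
    fun p hp _ _ => LiebAndo.jointlyConcave_liebTrace_div K hp,
    ⟨fun A B hA hB => LiebAndo.tendsto_liebTrace_one K hA hB,
      LiebAndo.jointlyConcave_limit_one K⟩,
    ⟨fun A B hA hB => LiebAndo.tendsto_liebTrace_zero K hA hB,
      LiebAndo.jointlyConcave_limit_zero K⟩,
    fun p hp => LiebAndo.jointlyConcave_liebTrace K (Set.Ioo_subset_Icc_self hp),
    fun p hp => LiebAndo.jointlyConvex_liebTrace K (Or.inr hp)⟩
  · rw [LiebAndo.perspective_g_eq hA hB (hg hp),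
      LiebAndo.tpow_one_zero hA (LiebAndo.posDef_map_star hB), LiebAndo.tpow]
  · exact (LiebAndo.jointlyConvex_g_tpow hp).comp_map_star.congr fun A B hA hB =>
      (LiebAndo.perspective_g_eq hA hB (hg hp)).symm
  · rw [e1 p A B hA hB, Complex.sub_im, LiebAndo.liebTrace_im K _ hA hB,
      LiebAndo.liebTrace_im K _ hA hB, sub_zero]
  · exact (LiebAndo.jointlyConvex_g_liebTrace K hp).congr fun A B hA hB => by
      rw [e1 p A B hA hB, Complex.sub_re]
  · rw [LiebAndo.perspective_h_eq hA hB (hh hq),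
      LiebAndo.tpow_zero_one hA (LiebAndo.posDef_map_star hB), LiebAndo.tpow]
  · exact (LiebAndo.jointlyConvex_h_tpow hq).comp_map_star.congr fun A B hA hB =>
      (LiebAndo.perspective_h_eq hA hB (hh hq)).symm
  · rw [e0 q A B hA hB, Complex.sub_im, LiebAndo.liebTrace_im K _ hA hB,
      LiebAndo.liebTrace_im K _ hA hB, sub_zero]
  · exact (LiebAndo.jointlyConvex_h_liebTrace K hq).congr fun A B hA hB => by
      rw [e0 q A B hA hB, Complex.sub_re]
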